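/- For an entire function $f:\mathbb{C}\to\mathbb{C}$ let $\mathrm{type}(f)$ be the infimum of all real $\beta$ such that $|f(z)|\le Ce^{\beta|z|}$ for all $z\in\mathbb{C}$ with some constant $C$ ($+\infty$ if there is no such $\beta$). For locally integrable $g:\mathbb{R}\to\mathbb{C}$ put $$\|g\|_{BMO}=\sup_I\frac1{|I|}\int_I\Big|g(t)-\frac1{|I|}\int_I g(s)\,ds\Big|\,dt,$$ the supremum being over all bounded intervals $I\subset\mathbb{R}$ of positive length. For $b\ge 0$ let $PW_b^\star$ be the space of entire functions $f$ with $\mathrm{type}(f)\le\pi b$ and $\|f|_{\mathbb{R}}\|_{BMO}<\infty$, and let $PW_b^\infty$ be the space of $g\in L^\infty(\mathbb{R})$ whose Fourier transform $\hat g$, in the sense of tempered distributions with the normalization $\hat g(\omega)=\int g(t)e^{-2\pi i\omega t}\,dt$, is supported in $[-\frac b2,\frac b2]$. A strictly increasing sequence $X=\{x_k\}_{k\in\mathbb{Z}}\subset\mathbb{R}$ is separated if $\inf_k|x_{k+1}-x_k|>0$, and its lower uniform density is $$D^-(X)=\limsup_{r\to\infty}\,\inf_{a\in\mathbb{R}}\frac{\#\{k:\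 x_k\in[a,a+r)\}}{r}.$$ Let $b\ge 0$ and $f\in PW_b^\star$. Then either $f|_{\mathbb{R}}\in PW_b^\infty$, or there is no separated sequence $X$ with $D^-(X)>0$ such that $f(X)=\{f(x_k)\}_{k\in\mathbb{Z}}$ is bounded. In particular, if $f|_{\mathbb{R}}\notin PW_b^\infty$, then for every sampling rate $s>0$ the samples $\{f(k/s)\}_{k\in\mathbb{Z}}$ are unbounded. -/

import Mathlib

open MeasureTheory Filter
open scoped ENNReal FourierTransform SchwartzMap

noncomputable section

namespace BandlimitedBMO

/-- The exponential type of `f : ℂ → ℂ`: the infimum of all real `β` for which `f` is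
`O(exp (β |z|))` on `ℂ`. It is `⊤` if `f` is not entire or satisfies no such bound. -/
def exponentialType (f : ℂ → ℂ) : EReal :=
  ⨅ (β : ℝ) (_ : Differentiable ℂ f ∧ ∃ C : ℝ, ∀ z : ℂ, ‖f z‖ ≤ C * Real.exp (β * ‖z‖)),
    (β : EReal)

/-- The `BMO` seminorm of `g : ℝ → ℂ`: the supremum over all bounded intervals `I` of the mean
over `I` of `|g - g_I|`, where `g_I` is the mean of `g` over `I`. -/
def bmoSeminorm (g : ℝ → ℂ) : ℝ≥0∞ :=
  ⨆ (u : ℝ) (v : ℝ) (_ : u < v),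
    ⨍⁻ t in Set.Icc u v, ‖g t - ⨍ s in Set.Icc u v, g s‖ₑ ∂volume

/-- `g` is locally integrable and of bounded mean oscillation. -/
def MemBMO (g : ℝ → ℂ) : Prop :=
  LocallyIntegrable g ∧ bmoSeminorm g < ∞

/-- The space `PW_b^⋆` of entire functions of exponential type at most `π b` whose restriction
to the real line lies in `BMO`. -/
def PWStar (b : ℝ) : Set (ℂ → ℂ) :=
  {f | exponentialType f ≤ ((Real.pi * b : ℝ) : EReal) ∧ MemBMO (fun t : ℝ => f t)}

/-- The Paley-Wiener space `PW_b^p` of all `g ∈ L^p(ℝ)` whose Fourier transform, in the sense of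
tempered distributions, is supported in `[-b/2, b/2]`. -/
def PW (b : ℝ) (p : ℝ≥0∞) [Fact (1 ≤ p)] : Set (ℝ → ℂ) :=
  {g | ∃ hg : MemLp g p volume,
    Distribution.dsupport (𝓕 (hg.toLp g : 𝓢'(ℝ, ℂ)) : 𝓢'(ℝ, ℂ)) ⊆ Set.Icc (-(b / 2)) (b / 2)}

/-- The separation constant of a sequence of points. -/
def separationConstant (x : ℤ → ℝ) : ℝ :=
  ⨅ k : ℤ, |x (k + 1) - x k|

/-- A separated sequence: strictly increasing, with positive separation constant. -/
def IsSeparatedSeq (x : ℤ → ℝ) : Prop :=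
  StrictMono x ∧ 0 < separationConstant x

/-- The number of points of the sequence in a set `I`. -/
def pointCount (x : ℤ → ℝ) (I : Set ℝ) : ℕ∞ :=
  {k : ℤ | x k ∈ I}.encard

/-- The lower uniform density of a sequence of points. -/
def lowerUniformDensity (x : ℤ → ℝ) : ℝ≥0∞ :=
  limsup (fun r : ℝ => ⨅ a : ℝ, (pointCount x (Set.Ico a (a + r)) : ℝ≥0∞) / ENNReal.ofReal r)
    atTop

end BandlimitedBMO

end

/-!
Let `F` be an entire primitive of `f`. Subtracting the mean of `f` over `[x, x + 2h]` does not
change the second difference of `F` at `x` with step `h`, so a finite BMO norm bounds it uniformly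
in `x`, for every fixed `h > 0`. Taylor's formula compares `h⁻² Δ_h² F` with `F'' = f'`: the error
is at most `2h` times a local supremum of `F'''`, which for a function of exponential type is
controlled by a supremum of `F''` on the real line (Phragmén–Lindelöf and Cauchy). For small `h`
this gives `sup |f'| ≤ a + sup |f'| / 2`, hence `sup |f'| ≤ 2a` once the supremum is finite.
Finiteness is not known in advance: the bound on the second differences with step `1` only yields
`f' = O(1 + x²)`, so the argument is run with the weights `(1 + ε|x|)²` and then `ε → 0`.

So `f` is Lipschitz on the real line, and it is bounded there as soon as it is bounded on a
relatively dense set. A bounded `f` of type at most `πb` has Fourier transform supported in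
`[-b/2, b/2]` by Paley–Wiener: damp `f` to an integrable function and shift the contour.
-/

namespace BandlimitedBMO

open Complex Metric Set Topology fwdDiff
open scoped NNReal

section ExponentialType

variable {E : Type*} [NormedAddCommGroup E] [NormedSpace ℂ E]

theorem one_le_norm_one_add_mul {ε : ℝ} {w : ℂ} (hε : 0 ≤ ε) (hw : 0 ≤ w.re) :
    1 ≤ ‖1 + (ε : ℂ) * w‖ := by
  have hre := re_le_norm (1 + (ε : ℂ) * w)
  rw [add_re, one_re, re_ofReal_mul] at hre
  linarith [mul_nonneg hε hw]

theorem norm_le_mul_exp_of_norm_le_imaginary_axis {g : ℂ → E} {C M β : ℝ}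
    (hg : DiffContOnCl ℂ g {z | 0 < z.re})
    (hexp : ∀ z : ℂ, 0 ≤ z.re → ‖g z‖ ≤ C * Real.exp (β * ‖z‖))
    (hM : ∀ y : ℝ, ‖g (y * I)‖ ≤ M) {w : ℂ} (hw : 0 ≤ w.re) :
    ‖g w‖ ≤ M * Real.exp (β * w.re) := by
  have hC0 : 0 ≤ C := by simpa using (norm_nonneg _).trans (hexp 0 le_rfl)
  set G : ℂ → E := fun z => cexp (-(β * z)) • g z with hG
  have hGnorm (z : ℂ) : ‖G z‖ = Real.exp (-(β * z.re)) * ‖g z‖ := by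
    simp [hG, norm_smul, norm_exp]
  have hGle {z : ℂ} (hz : 0 ≤ z.re) : ‖G z‖ ≤ C * Real.exp (β * ‖z‖ - β * z.re) := by
    rw [hGnorm, sub_eq_neg_add, Real.exp_add, mul_left_comm]
    gcongr
    exact hexp z hz
  have hGbound : ‖G w‖ ≤ M := by
    refine PhragmenLindelof.right_half_plane_of_bounded_on_real
      (DiffContOnCl.smul (Differentiable.diffContOnCl (by fun_prop)) hg)
      ⟨1, one_lt_two, 2 * |β|, .of_bound C <| eventually_inf_principal.2 <|
        .of_forall fun z hz => (hGle (le_of_lt hz)).trans ?_⟩ ?_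
      (fun y => by simpa [hGnorm] using hM y) hw
    · have h₁ := mul_le_mul_of_nonneg_right (le_abs_self β) (norm_nonneg z)
      have h₂ := mul_le_mul_of_nonneg_right (neg_le_abs β) (le_of_lt hz)
      have h₃ := mul_le_mul_of_nonneg_left (re_le_norm z) (abs_nonneg β)
      rw [Real.rpow_one, Real.norm_eq_abs, Real.abs_exp]
      gcongr
      linarith
    · refine ⟨C, eventually_map.2 ?_⟩
      filter_upwards [eventually_ge_atTop 0] with x hx
      simpa [abs_of_nonneg hx] using hGle (z := x) (by simpa using hx)
  rwa [hGnorm, Real.exp_neg, inv_mul_le_iff₀' (Real.exp_pos _)] at hGbound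

/-- `HasExpType f β` says that `f` is entire and `O(exp (β |z|))` on `ℂ`. Unlike
`exponentialType f ≤ β`, it asks for the bound at the rate `β` itself, not just at every larger
one. -/
structure HasExpType (f : ℂ → E) (β : ℝ) : Prop where
  differentiable : Differentiable ℂ f
  exists_bound : ∃ C, ∀ z, ‖f z‖ ≤ C * Real.exp (β * ‖z‖)

namespace HasExpType

variable {f F : ℂ → E} {β ε M : ℝ}

theorem exists_nonneg_bound (hf : HasExpType f β) :
    ∃ C, 0 ≤ C ∧ ∀ z, ‖f z‖ ≤ C * Real.exp (β * ‖z‖) := by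
  obtain ⟨C, hC⟩ := hf.exists_bound
  exact ⟨C, by simpa using (norm_nonneg _).trans (hC 0), hC⟩

theorem mono {β' : ℝ} (hf : HasExpType f β) (hβ : β ≤ β') : HasExpType f β' := by
  obtain ⟨C, hC0, hC⟩ := hf.exists_nonneg_bound
  exact ⟨hf.differentiable, C, fun z => (hC z).trans (by gcongr)⟩

theorem comp_const_mul {c : ℂ} (hf : HasExpType f β) (hc : ‖c‖ = 1) :
    HasExpType (fun z => f (c * z)) β := by
  obtain ⟨C, hC⟩ := hf.exists_bound
  exact ⟨hf.differentiable.comp (differentiable_id.const_mul c), C,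
    fun z => by simpa [hc] using hC (c * z)⟩

protected theorem deriv [CompleteSpace E] (hf : HasExpType f β) : HasExpType (deriv f) β := by
  obtain ⟨C, hC0, hC⟩ := hf.exists_nonneg_bound
  refine ⟨fun z => (hf.differentiable.analyticAt z).deriv.differentiableAt,
    C * Real.exp |β|, fun z => ?_⟩
  suffices ∀ w ∈ sphere z 1, ‖f w‖ ≤ C * Real.exp |β| * Real.exp (β * ‖z‖) by
    simpa using norm_deriv_le_of_forall_mem_sphere_norm_le one_pos
      hf.differentiable.diffContOnCl this
  intro w hw
  have hdist : |‖w‖ - ‖z‖| ≤ 1 := (abs_norm_sub_norm_le w z).trans (mem_sphere_iff_norm.1 hw).le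
  have hexponent : β * ‖w‖ ≤ |β| + β * ‖z‖ := by
    have : β * (‖w‖ - ‖z‖) ≤ |β| * 1 :=
      (le_abs_self _).trans (by rw [abs_mul]; gcongr)
    linarith
  calc ‖f w‖ ≤ C * Real.exp (β * ‖w‖) := hC w
    _ ≤ C * Real.exp (|β| + β * ‖z‖) := by gcongr
    _ = C * Real.exp |β| * Real.exp (β * ‖z‖) := by rw [Real.exp_add, mul_assoc]

theorem of_hasDerivAt (hf : HasExpType f β) (hF : ∀ z, HasDerivAt F (f z) z) :
    HasExpType F (|β| + 1) := by
  obtain ⟨C, hC0, hC⟩ := (hf.mono (le_abs_self β)).exists_nonneg_bound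
  refine ⟨fun z => (hF z).differentiableAt, ‖F 0‖ + C, fun z => ?_⟩
  have hsub : ‖F z - F 0‖ ≤ C * Real.exp (|β| * ‖z‖) * ‖z - 0‖ :=
    (convex_closedBall (0 : ℂ) ‖z‖).norm_image_sub_le_of_norm_hasDerivWithin_le
      (fun y _ => (hF y).hasDerivWithinAt)
      (fun y hy => (hC y).trans (by gcongr; exact mem_closedBall_zero_iff.1 hy))
      (by simp) (by simp)
  have hnorm : ‖z‖ ≤ Real.exp ‖z‖ := (lt_add_one _).le.trans (Real.add_one_le_exp _)
  calc ‖F z‖ ≤ ‖F 0‖ + ‖F z - F 0‖ := norm_le_norm_add_norm_sub' _ _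
    _ ≤ ‖F 0‖ * Real.exp ((|β| + 1) * ‖z‖)
        + C * (Real.exp (|β| * ‖z‖) * Real.exp ‖z‖) := by
      rw [sub_zero, mul_assoc] at hsub
      refine add_le_add (le_mul_of_one_le_right (norm_nonneg _) ?_) (hsub.trans (by gcongr))
      exact Real.one_le_exp (by positivity)
    _ = (‖F 0‖ + C) * Real.exp ((|β| + 1) * ‖z‖) := by
      rw [← Real.exp_add, add_mul, add_mul, one_mul]

theorem norm_le_of_norm_le_imaginary_axis {n : ℕ} (hf : HasExpType f β) (hε : 0 ≤ ε)
    (hM : ∀ y : ℝ, ‖f (y * I)‖ ≤ M * (1 + ε * |y|) ^ n) {w : ℂ} (hw : 0 ≤ w.re) :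
    ‖f w‖ ≤ M * (2 * (1 + ε * ‖w‖)) ^ n * Real.exp (β * w.re) := by
  obtain ⟨C, -, hC⟩ := hf.exists_nonneg_bound
  have hM0 : 0 ≤ M := by simpa using (norm_nonneg _).trans (hM 0)
  have hden {z : ℂ} (hz : 0 ≤ z.re) : 0 < ‖1 + (ε : ℂ) * z‖ :=
    one_pos.trans_le (one_le_norm_one_add_mul hε hz)
  set G : ℂ → E := fun z => ((1 + ε * z) ^ n)⁻¹ • f z with hG
  have hGnorm (z : ℂ) : ‖G z‖ = (‖1 + (ε : ℂ) * z‖ ^ n)⁻¹ * ‖f z‖ := by simp [hG, norm_smul]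
  have hGdiff : DiffContOnCl ℂ G {z | 0 < z.re} := by
    apply DifferentiableOn.diffContOnCl
    rw [closure_setOfPred_lt_re]
    intro z hz
    have hne : (1 + (ε : ℂ) * z) ^ n ≠ 0 := pow_ne_zero _ (norm_pos_iff.1 (hden hz))
    exact (DifferentiableAt.smul (by fun_prop (disch := exact hne))
      (hf.differentiable z)).differentiableWithinAt
  have hGexp (z : ℂ) (hz : 0 ≤ z.re) : ‖G z‖ ≤ C * Real.exp (β * ‖z‖) := by
    rw [hGnorm]
    exact (mul_le_of_le_one_left (norm_nonneg _) (inv_le_one_of_one_le₀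
      (one_le_pow₀ (one_le_norm_one_add_mul hε hz)))).trans (hC z)
  have hGimag (y : ℝ) : ‖G (y * I)‖ ≤ M * 2 ^ n := by
    have hweight : 1 + ε * |y| ≤ 2 * ‖1 + (ε : ℂ) * (y * I)‖ := by
      have hre : 1 ≤ ‖1 + (ε : ℂ) * (y * I)‖ := one_le_norm_one_add_mul hε (by simp)
      have him : ε * |y| ≤ ‖1 + (ε : ℂ) * (y * I)‖ := by
        simpa [abs_mul, abs_of_nonneg hε] using abs_im_le_norm (1 + (ε : ℂ) * (y * I))
      linarith
    rw [hGnorm, inv_mul_le_iff₀' (pow_pos (hden (by simp)) n), mul_assoc, ← mul_pow]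
    exact (hM y).trans (by gcongr)
  have hnorm : ‖1 + (ε : ℂ) * w‖ ≤ 1 + ε * ‖w‖ := by
    simpa [abs_of_nonneg hε] using norm_add_le 1 ((ε : ℂ) * w)
  calc ‖f w‖ = ‖G w‖ * ‖1 + (ε : ℂ) * w‖ ^ n := by
        rw [hGnorm, mul_comm, mul_inv_cancel_left₀ (pow_pos (hden hw) n).ne']
    _ ≤ M * 2 ^ n * Real.exp (β * w.re) * (1 + ε * ‖w‖) ^ n := by
      gcongr
      exact norm_le_mul_exp_of_norm_le_imaginary_axis hGdiff hGexp hGimag hw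
    _ = M * (2 * (1 + ε * ‖w‖)) ^ n * Real.exp (β * w.re) := by rw [mul_pow]; ring

theorem norm_le_of_norm_le_real_axis {n : ℕ} (hf : HasExpType f β) (hε : 0 ≤ ε)
    (hM : ∀ x : ℝ, ‖f x‖ ≤ M * (1 + ε * |x|) ^ n) (z : ℂ) :
    ‖f z‖ ≤ M * (2 * (1 + ε * ‖z‖)) ^ n * Real.exp (β * |z.im|) := by
  rcases le_total 0 z.im with h | h
  · have hrot := (hf.comp_const_mul norm_I).norm_le_of_norm_le_imaginary_axis hε
      (fun y => by simpa [mul_left_comm I] using hM (-y)) (w := -I * z) (by simpa using h)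
    simpa [abs_of_nonneg h, ← mul_assoc] using hrot
  · have hrot := (hf.comp_const_mul (c := -I) (by simp)).norm_le_of_norm_le_imaginary_axis hε
      (fun y => by simpa [mul_left_comm I] using hM y) (w := I * z) (by simpa using h)
    simpa [abs_of_nonpos h, ← mul_assoc] using hrot

theorem norm_deriv_le_of_norm_le_real_axis {n : ℕ} (hf : HasExpType f β) (hε : 0 ≤ ε)
    (hε1 : ε ≤ 1) (hM : ∀ x : ℝ, ‖f x‖ ≤ M * (1 + ε * |x|) ^ n) {x : ℝ} {z : ℂ} (hz : ‖z - x‖ ≤ 1) :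
    ‖deriv f z‖ ≤ Real.exp (2 * |β|) * 6 ^ n * M * (1 + ε * |x|) ^ n := by
  have hM0 : 0 ≤ M := by simpa using (norm_nonneg _).trans (hM 0)
  suffices ∀ w ∈ sphere z 1, ‖f w‖ ≤ Real.exp (2 * |β|) * 6 ^ n * M * (1 + ε * |x|) ^ n by
    simpa using norm_deriv_le_of_forall_mem_sphere_norm_le one_pos
      hf.differentiable.diffContOnCl this
  intro w hw
  have hwx : ‖w - x‖ ≤ 2 := by
    linarith [norm_sub_le_norm_sub_add_norm_sub w z (x : ℂ), mem_sphere_iff_norm.1 hw]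
  have hnorm : ‖w‖ ≤ |x| + 2 := by
    linarith [norm_le_norm_add_norm_sub' w (x : ℂ), norm_real x, Real.norm_eq_abs x]
  have him : |w.im| ≤ 2 := by simpa using (abs_im_le_norm (w - x)).trans hwx
  have hweight : 1 + ε * ‖w‖ ≤ 3 * (1 + ε * |x|) := by
    linarith [mul_nonneg hε (abs_nonneg x), mul_le_mul_of_nonneg_left hnorm hε]
  calc ‖f w‖ ≤ M * (2 * (1 + ε * ‖w‖)) ^ n * Real.exp (β * |w.im|) :=
        hf.norm_le_of_norm_le_real_axis hε hM w
    _ ≤ M * (2 * (3 * (1 + ε * |x|))) ^ n * Real.exp (|β| * 2) := by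
      gcongr
      exact le_abs_self β
    _ = Real.exp (2 * |β|) * 6 ^ n * M * (1 + ε * |x|) ^ n := by
      rw [← mul_assoc 2, show (2 * 3 : ℝ) = 6 by norm_num, mul_pow, mul_comm |β|]
      ring

end HasExpType

end ExponentialType

section ForwardDifference

variable {E : Type*} [NormedAddCommGroup E]

theorem norm_add_natCast_sub_le {ψ : ℝ → E} {A : ℝ} {n : ℕ}
    (hψ : ∀ x, ‖Δ_[1] ψ x‖ ≤ A * (1 + |x|) ^ n) (x : ℝ) (m : ℕ) :
    ‖ψ (x + m) - ψ x‖ ≤ m * (A * (1 + (|x| + m)) ^ n) := by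
  have hA : 0 ≤ A := by simpa using (norm_nonneg _).trans (hψ 0)
  have hstep : ∀ i ∈ Finset.range m,
      ‖ψ (x + (i + 1 : ℕ)) - ψ (x + i)‖ ≤ A * (1 + (|x| + m)) ^ n := by
    intro i hi
    have hi' : (i : ℝ) ≤ m := by exact_mod_cast (Finset.mem_range.1 hi).le
    have habs : |x + i| ≤ |x| + m := (abs_add_le _ _).trans (by simpa using hi')
    calc ‖ψ (x + (i + 1 : ℕ)) - ψ (x + i)‖ = ‖Δ_[1] ψ (x + i)‖ := by simp [fwdDiff, add_assoc]
      _ ≤ A * (1 + |x + i|) ^ n := hψ _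
      _ ≤ A * (1 + (|x| + m)) ^ n := by gcongr
  have htelescope : ∑ i ∈ Finset.range m, (ψ (x + (i + 1 : ℕ)) - ψ (x + i)) = ψ (x + m) - ψ x := by
    simpa using Finset.sum_range_sub (fun i : ℕ => ψ (x + i)) m
  simpa only [htelescope, Finset.sum_const, Finset.card_range, nsmul_eq_mul] using
    norm_sum_le_of_le _ hstep

theorem exists_norm_le_one_add_abs_pow_of_fwdDiff {ψ : ℝ → E} (hψ : Continuous ψ) {A : ℝ} {n : ℕ}
    (h : ∀ x, ‖Δ_[1] ψ x‖ ≤ A * (1 + |x|) ^ n) :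
    ∃ K, ∀ x, ‖ψ x‖ ≤ K * (1 + |x|) ^ (n + 1) := by
  obtain ⟨K, hK⟩ := isCompact_Icc.exists_bound_of_continuousOn (s := Icc (0 : ℝ) 1) hψ.continuousOn
  have hA : 0 ≤ A := by simpa using (norm_nonneg _).trans (h 0)
  have hK0 : 0 ≤ K := (norm_nonneg _).trans (hK 0 (by simp))
  refine ⟨K + A * 2 ^ n, fun x => ?_⟩
  have hfract : ‖ψ (Int.fract x)‖ ≤ K := hK _ ⟨Int.fract_nonneg x, (Int.fract_lt_one x).le⟩
  have hle {y : ℝ} {m : ℕ} (hm : (m : ℝ) ≤ 1 + |x|) (hym : |y| + m ≤ 1 + 2 * |x|) :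
      (m : ℝ) * (A * (1 + (|y| + m)) ^ n) ≤ (1 + |x|) * (A * (2 * (1 + |x|)) ^ n) := by
    gcongr
    linarith
  have hshift : ‖ψ x - ψ (Int.fract x)‖ ≤ (1 + |x|) * (A * (2 * (1 + |x|)) ^ n) := by
    have hfract0 := Int.fract_nonneg x
    have hfract1 := Int.fract_lt_one x
    have hfloor := Int.fract_add_floor x
    obtain ⟨m, hm | hm⟩ := Int.eq_nat_or_neg ⌊x⌋ <;> rw [hm] at hfloor <;> push_cast at hfloor
    · have hbound := norm_add_natCast_sub_le h (Int.fract x) m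
      rw [hfloor] at hbound
      refine hbound.trans (hle ?_ ?_) <;> linarith [le_abs_self x, abs_of_nonneg hfract0]
    · have hbound := norm_add_natCast_sub_le h x m
      rw [show x + m = Int.fract x by linarith, norm_sub_rev] at hbound
      refine hbound.trans (hle ?_ ?_) <;> linarith [neg_le_abs x]
  have hone : 1 ≤ (1 + |x|) ^ (n + 1) := one_le_pow₀ (by linarith [abs_nonneg x])
  calc ‖ψ x‖ ≤ ‖ψ (Int.fract x)‖ + ‖ψ x - ψ (Int.fract x)‖ := norm_le_norm_add_norm_sub' _ _
    _ ≤ K * (1 + |x|) ^ (n + 1) + (1 + |x|) * (A * (2 * (1 + |x|)) ^ n) :=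
      add_le_add (hfract.trans (le_mul_of_one_le_right hK0 hone)) hshift
    _ = (K + A * 2 ^ n) * (1 + |x|) ^ (n + 1) := by rw [mul_pow]; ring

variable {𝕜 : Type*} [RCLike 𝕜] [NormedSpace 𝕜 E]

theorem norm_fwdDiff_sub_smul_le {f f' : 𝕜 → E} {s : Set 𝕜} (hs : Convex ℝ s)
    (hf : ∀ z ∈ s, HasDerivWithinAt f (f' z) s z) {c : E} {C : ℝ} (hC : ∀ z ∈ s, ‖f' z - c‖ ≤ C)
    {x h : 𝕜} (hx : x ∈ s) (hxh : x + h ∈ s) : ‖Δ_[h] f x - h • c‖ ≤ C * ‖h‖ := by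
  have hd (z : 𝕜) (hz : z ∈ s) : HasDerivWithinAt (fun z => f z - z • c) (f' z - c) s z := by
    simpa using (hf z hz).fun_sub ((hasDerivWithinAt_id z s).smul_const c)
  have hmvt := hs.norm_image_sub_le_of_norm_hasDerivWithin_le hd hC hx hxh
  rw [add_sub_cancel_left] at hmvt
  convert hmvt using 2
  rw [fwdDiff, add_smul]
  abel

theorem norm_fwdDiff_fwdDiff_sub_smul_le {F f g g' : 𝕜 → E} {x h : 𝕜} {L : ℝ}
    (hF : ∀ z, HasDerivAt F (f z) z) (hf : ∀ z, HasDerivAt f (g z) z)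
    (hg : ∀ z, HasDerivAt g (g' z) z) (hL : ∀ z, ‖z - x‖ ≤ 2 * ‖h‖ → ‖g' z‖ ≤ L) :
    ‖Δ_[h] (Δ_[h] F) x - h • h • g x‖ ≤ 2 * ‖h‖ ^ 3 * L := by
  have hL0 : 0 ≤ L := (norm_nonneg _).trans (hL x (by simp))
  have hg_near (z : 𝕜) (hz : z ∈ closedBall x (2 * ‖h‖)) : ‖g z - g x‖ ≤ L * (2 * ‖h‖) :=
    ((convex_closedBall x (2 * ‖h‖)).norm_image_sub_le_of_norm_hasDerivWithin_le
      (fun y _ => (hg y).hasDerivWithinAt) (fun y hy => hL y (mem_closedBall_iff_norm.1 hy))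
      (mem_closedBall_self (by positivity)) hz).trans
      (by gcongr; exact mem_closedBall_iff_norm.1 hz)
  have hf_near (z : 𝕜) (hz : z ∈ closedBall x ‖h‖) :
      ‖Δ_[h] f z - h • g x‖ ≤ L * (2 * ‖h‖) * ‖h‖ := by
    rw [mem_closedBall_iff_norm] at hz
    refine norm_fwdDiff_sub_smul_le (convex_closedBall x (2 * ‖h‖))
      (fun y _ => (hf y).hasDerivWithinAt) hg_near ?_ ?_ <;> rw [mem_closedBall_iff_norm]
    · linarith [norm_nonneg h]
    · rw [add_sub_right_comm]
      linarith [norm_add_le (z - x) h]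
  calc ‖Δ_[h] (Δ_[h] F) x - h • h • g x‖ ≤ L * (2 * ‖h‖) * ‖h‖ * ‖h‖ :=
        norm_fwdDiff_sub_smul_le (convex_closedBall x ‖h‖)
          (fun y _ => (((hF (y + h)).comp_add_const y h).sub (hF y)).hasDerivWithinAt)
          hf_near (mem_closedBall_self (norm_nonneg h)) (by simp)
    _ = 2 * ‖h‖ ^ 3 * L := by ring

end ForwardDifference

theorem norm_le_two_mul_of_self_improving {α E : Type*} [NormedAddCommGroup E] {g : α → E}
    {ρ : α → ℝ} (hρ : ∀ x, 0 ≤ ρ x) {n : ℕ} {K a : ℝ} (hK : ∀ x, ‖g x‖ ≤ K * (1 + ρ x) ^ n)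
    (hstep : ∀ ε ∈ Ioc (0 : ℝ) 1, ∀ M, (∀ x, ‖g x‖ ≤ M * (1 + ε * ρ x) ^ n) →
      ∀ x, ‖g x‖ ≤ (a + M / 2) * (1 + ε * ρ x) ^ n) (x : α) :
    ‖g x‖ ≤ 2 * a := by
  have hweighted (ε : ℝ) (hε : ε ∈ Ioc (0 : ℝ) 1) : ‖g x‖ ≤ 2 * a * (1 + ε * ρ x) ^ n := by
    have hpos (y : α) : 0 < (1 + ε * ρ y) ^ n := by
      have := mul_nonneg hε.1.le (hρ y)
      positivity
    have hbdd : BddAbove (range fun y => ‖g y‖ / (1 + ε * ρ y) ^ n) := by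
      refine ⟨|K| * (ε⁻¹) ^ n, ?_⟩
      rintro _ ⟨y, rfl⟩
      rw [div_le_iff₀ (hpos y), mul_assoc, ← mul_pow]
      have hy := hρ y
      have hcompare : 1 + ρ y ≤ ε⁻¹ * (1 + ε * ρ y) := by
        rw [mul_add, inv_mul_cancel_left₀ hε.1.ne', mul_one]
        gcongr
        exact (one_le_inv₀ hε.1).2 hε.2
      calc ‖g y‖ ≤ K * (1 + ρ y) ^ n := hK y
        _ ≤ |K| * (ε⁻¹ * (1 + ε * ρ y)) ^ n := by gcongr; exact le_abs_self K
    have hle (y : α) : ‖g y‖ ≤ (⨆ y, ‖g y‖ / (1 + ε * ρ y) ^ n) * (1 + ε * ρ y) ^ n :=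
      (div_le_iff₀ (hpos y)).1 (le_ciSup hbdd y)
    have : Nonempty α := ⟨x⟩
    have hsup : (⨆ y, ‖g y‖ / (1 + ε * ρ y) ^ n) ≤ a + (⨆ y, ‖g y‖ / (1 + ε * ρ y) ^ n) / 2 :=
      ciSup_le fun y => (div_le_iff₀ (hpos y)).2 (hstep ε hε _ hle y)
    exact (hle x).trans (mul_le_mul_of_nonneg_right (by linarith) (hpos x).le)
  have hlim : Tendsto (fun ε : ℝ => 2 * a * (1 + ε * ρ x) ^ n) (𝓝[>] 0) (𝓝 (2 * a)) := by
    have hcont : Continuous fun ε : ℝ => 2 * a * (1 + ε * ρ x) ^ n := by fun_prop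
    simpa using (hcont.tendsto 0).mono_left nhdsWithin_le_nhds
  exact ge_of_tendsto hlim (eventually_of_mem (Ioc_mem_nhdsGT one_pos) hweighted)

namespace HasExpType

variable {E : Type*} [NormedAddCommGroup E] [NormedSpace ℂ E] [CompleteSpace E]
  {F : ℂ → E} {β : ℝ}

theorem exists_norm_deriv_deriv_le_one_add_abs_sq (hF : HasExpType F β) {B : ℝ}
    (hB : ∀ x : ℝ, ‖Δ_[1] (Δ_[1] F) x‖ ≤ B) :
    ∃ K, ∀ x : ℝ, ‖deriv (deriv F) x‖ ≤ K * (1 + |x|) ^ 2 := by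
  have hcont : Continuous fun x : ℝ => F x := hF.differentiable.continuous.comp continuous_ofReal
  obtain ⟨A, hA⟩ := exists_norm_le_one_add_abs_pow_of_fwdDiff
    (ψ := Δ_[1] fun x : ℝ => F x) (A := B) (n := 0)
    ((hcont.comp (continuous_add_const 1)).sub hcont)
    (fun x => by simpa [fwdDiff] using hB x)
  obtain ⟨K, hK⟩ := exists_norm_le_one_add_abs_pow_of_fwdDiff hcont hA
  have hderiv (x : ℝ) := hF.norm_deriv_le_of_norm_le_real_axis zero_le_one le_rfl
    (by simpa using hK) (x := x) (z := x) (by simp)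
  have hderiv' (x : ℝ) := hF.deriv.norm_deriv_le_of_norm_le_real_axis zero_le_one le_rfl
    hderiv (x := x) (z := x) (by simp)
  exact ⟨_, by simpa using hderiv'⟩

-- The step `h` makes the Taylor error `2h³ · 36 exp (2|β|) M` equal to `h² M / 2`.
theorem norm_deriv_deriv_le_add_half (hF : HasExpType F β) {h : ℝ}
    (hh : h = (144 * Real.exp (2 * |β|))⁻¹) {B : ℝ}
    (hB : ∀ x : ℝ, ‖Δ_[(h : ℂ)] (Δ_[(h : ℂ)] F) x‖ ≤ B) {ε M : ℝ} (hε : 0 ≤ ε) (hε1 : ε ≤ 1)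
    (hM : ∀ x : ℝ, ‖deriv (deriv F) x‖ ≤ M * (1 + ε * |x|) ^ 2) (x : ℝ) :
    ‖deriv (deriv F) x‖ ≤ (B / h ^ 2 + M / 2) * (1 + ε * |x|) ^ 2 := by
  have hpos : 0 < h := by rw [hh]; positivity
  have hmul : h * (144 * Real.exp (2 * |β|)) = 1 := by
    rw [hh]; exact inv_mul_cancel₀ (by positivity)
  have hsmall : 2 * h ≤ 1 := by
    have := Real.one_le_exp (mul_nonneg zero_le_two (abs_nonneg β))
    nlinarith
  have hB0 : 0 ≤ B := (norm_nonneg _).trans (hB 0)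
  have hnorm : ‖(h : ℂ)‖ = h := by simp [hpos.le]
  have htaylor := norm_fwdDiff_fwdDiff_sub_smul_le (x := (x : ℂ)) (h := (h : ℂ))
    (fun z => (hF.differentiable z).hasDerivAt) (fun z => (hF.deriv.differentiable z).hasDerivAt)
    (fun z => (hF.deriv.deriv.differentiable z).hasDerivAt)
    (fun z hz => hF.deriv.deriv.norm_deriv_le_of_norm_le_real_axis hε hε1 hM
      (hz.trans (by rwa [hnorm])))
  have hscaled : h ^ 2 * ‖deriv (deriv F) x‖ ≤ B + h ^ 2 * (M / 2 * (1 + ε * |x|) ^ 2) := by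
    calc h ^ 2 * ‖deriv (deriv F) x‖ = ‖(h : ℂ) • (h : ℂ) • deriv (deriv F) x‖ := by
          rw [norm_smul, norm_smul, hnorm]; ring
      _ ≤ ‖Δ_[(h : ℂ)] (Δ_[(h : ℂ)] F) x‖
          + ‖Δ_[(h : ℂ)] (Δ_[(h : ℂ)] F) x - (h : ℂ) • (h : ℂ) • deriv (deriv F) x‖ :=
        norm_le_norm_add_norm_sub _ _
      _ ≤ B + 2 * h ^ 3 * (Real.exp (2 * |β|) * 6 ^ 2 * M * (1 + ε * |x|) ^ 2) := by
        rw [hnorm] at htaylor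
        exact add_le_add (hB x) htaylor
      _ = B + h ^ 2 * (M / 2 * (1 + ε * |x|) ^ 2) := by
        linear_combination (h ^ 2 * (M / 2) * (1 + ε * |x|) ^ 2) * hmul
  have hweight : 1 ≤ (1 + ε * |x|) ^ 2 :=
    one_le_pow₀ (le_add_of_nonneg_right (mul_nonneg hε (abs_nonneg x)))
  calc ‖deriv (deriv F) x‖ ≤ B / h ^ 2 + M / 2 * (1 + ε * |x|) ^ 2 := by
        rw [← mul_le_mul_iff_right₀ (pow_pos hpos 2), mul_add, mul_div_cancel₀ _ (by positivity)]
        exact hscaled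
    _ ≤ (B / h ^ 2 + M / 2) * (1 + ε * |x|) ^ 2 := by
      rw [add_mul]
      gcongr
      exact le_mul_of_one_le_right (by positivity) hweight

theorem exists_norm_deriv_deriv_le_of_fwdDiff_fwdDiff_le (hF : HasExpType F β)
    (hdiff : ∀ h : ℝ, 0 < h → ∃ B, ∀ x : ℝ, ‖Δ_[(h : ℂ)] (Δ_[(h : ℂ)] F) x‖ ≤ B) :
    ∃ L, ∀ x : ℝ, ‖deriv (deriv F) x‖ ≤ L := by
  obtain ⟨B₁, hB₁⟩ := hdiff 1 one_pos
  obtain ⟨K, hK⟩ := hF.exists_norm_deriv_deriv_le_one_add_abs_sq (by simpa using hB₁)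
  obtain ⟨B, hB⟩ := hdiff (144 * Real.exp (2 * |β|))⁻¹ (by positivity)
  exact ⟨_, norm_le_two_mul_of_self_improving abs_nonneg hK fun ε hε M hM =>
    hF.norm_deriv_deriv_le_add_half rfl hB hε.1.le hε.2 hM⟩

end HasExpType

section BMO

variable {g : ℝ → ℂ}

theorem integral_norm_sub_average_le (hg : MemBMO g) {u v : ℝ} (huv : u < v) :
    ∫ t in u..v, ‖g t - ⨍ s in Icc u v, g s‖ ≤ (bmoSeminorm g).toReal * (v - u) := by
  obtain ⟨hloc, hfin⟩ := hg
  set c := ⨍ s in Icc u v, g s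
  have hmean : ⨍⁻ t in Icc u v, ‖g t - c‖ₑ ∂volume ≤ bmoSeminorm g :=
    le_iSup_of_le u (le_iSup_of_le v (le_iSup_of_le huv le_rfl))
  rw [setLAverage_eq, Real.volume_Icc,
    ENNReal.div_le_iff (by simpa using huv) ENNReal.ofReal_ne_top] at hmean
  have hlintegral := ENNReal.toReal_mono (ENNReal.mul_ne_top hfin.ne ENNReal.ofReal_ne_top) hmean
  rw [intervalIntegral.integral_of_le huv.le, ← integral_Icc_eq_integral_Ioc,
    integral_norm_eq_lintegral_enorm
      (hloc.aestronglyMeasurable.restrict.fun_sub aestronglyMeasurable_const)]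
  rwa [ENNReal.toReal_mul, ENNReal.toReal_ofReal (sub_pos.2 huv).le] at hlintegral

theorem norm_fwdDiff_fwdDiff_primitive_le (hg : MemBMO g) {G : ℝ → ℂ}
    (hG : ∀ t, HasDerivAt G (g t) t) {h : ℝ} (hh : 0 < h) (x : ℝ) :
    ‖Δ_[h] (Δ_[h] G) x‖ ≤ (bmoSeminorm g).toReal * (2 * h) := by
  have hosc := integral_norm_sub_average_le hg (u := x) (v := x + h + h) (by linarith)
  set c := ⨍ s in Icc x (x + h + h), g s
  have hinteg (u v : ℝ) : IntervalIntegrable (fun t => g t - c) volume u v :=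
    (hg.1.integrableOn_isCompact isCompact_uIcc).intervalIntegrable.sub
      intervalIntegrable_const
  have hFTC (u v : ℝ) : ∫ t in u..v, (g t - c) = (G v - v • c) - (G u - u • c) :=
    intervalIntegral.integral_eq_sub_of_hasDerivAt (f := fun t => G t - t • c)
      (fun t _ => by simpa using (hG t).fun_sub ((hasDerivAt_id t).smul_const c)) (hinteg u v)
  have hdiff : Δ_[h] (Δ_[h] G) x
      = (∫ t in (x + h)..(x + h + h), (g t - c)) - ∫ t in x..(x + h), (g t - c) := by
    simp only [hFTC, fwdDiff, add_smul]
    abel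
  calc ‖Δ_[h] (Δ_[h] G) x‖
      ≤ ‖∫ t in (x + h)..(x + h + h), (g t - c)‖ + ‖∫ t in x..(x + h), (g t - c)‖ :=
        hdiff ▸ norm_sub_le _ _
    _ ≤ (∫ t in (x + h)..(x + h + h), ‖g t - c‖) + ∫ t in x..(x + h), ‖g t - c‖ := by
      gcongr <;> exact intervalIntegral.norm_integral_le_integral_norm (by linarith)
    _ = ∫ t in x..(x + h + h), ‖g t - c‖ := by
      rw [add_comm, intervalIntegral.integral_add_adjacent_intervals (hinteg _ _).norm
        (hinteg _ _).norm]
    _ ≤ (bmoSeminorm g).toReal * (2 * h) := by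
      convert hosc using 2
      ring

theorem HasExpType.exists_norm_deriv_le {f : ℂ → ℂ} {β : ℝ} (hf : HasExpType f β)
    (hbmo : MemBMO fun t : ℝ => f t) : ∃ L, ∀ x : ℝ, ‖deriv f x‖ ≤ L := by
  obtain ⟨F, hF⟩ := hf.differentiable.isExactOn_univ
  replace hF (z : ℂ) : HasDerivAt F (f z) z := hF z (mem_univ z)
  have hderiv : deriv F = f := funext fun z => (hF z).deriv
  simpa only [hderiv] using (hf.of_hasDerivAt hF).exists_norm_deriv_deriv_le_of_fwdDiff_fwdDiff_le
    fun h hh => ⟨_, fun x => by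
      simpa [fwdDiff] using
        norm_fwdDiff_fwdDiff_primitive_le hbmo (fun t => (hF t).comp_ofReal) hh x⟩

end BMO

section ContourShift

variable {E : Type*} [NormedAddCommGroup E] [NormedSpace ℂ E]

theorem norm_integral_le_div_of_norm_le_exp {h : ℝ → E} {A c R : ℝ} (hc : 0 < c) (hR : 0 ≤ R)
    (hh : ∀ y, 0 ≤ y → ‖h y‖ ≤ A * Real.exp (-c * y)) : ‖∫ y in (0 : ℝ)..R, h y‖ ≤ A / c := by
  have hA : 0 ≤ A := by simpa using (norm_nonneg _).trans (hh 0 le_rfl)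
  calc ‖∫ y in (0 : ℝ)..R, h y‖ ≤ ∫ y in (0 : ℝ)..R, A * Real.exp (-c * y) :=
        intervalIntegral.norm_integral_le_of_norm_le hR
          (Eventually.of_forall fun y hy => hh y hy.1.le)
          (Continuous.intervalIntegrable (by fun_prop) _ _)
    _ = A / c * (1 - Real.exp (-c * R)) := by
      simp only [intervalIntegral.integral_const_mul, intervalIntegral.integral_comp_mul_left _
        (neg_ne_zero.2 hc.ne'), integral_exp, smul_eq_mul, mul_zero, Real.exp_zero]
      field_simp
      ring
    _ ≤ A / c := mul_le_of_le_one_right (by positivity) (by linarith [Real.exp_pos (-c * R)])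

variable {H : ℂ → E} {φ : ℝ → ℝ} {c : ℝ}

theorem norm_integral_symm_interval_le_of_upperHalfPlane
    (hH : DiffContOnCl ℂ H {z | 0 < z.im}) (hc : 0 < c) (hφ : Integrable φ)
    (hbound : ∀ z : ℂ, 0 ≤ z.im → ‖H z‖ ≤ φ z.re * Real.exp (-c * z.im)) {R : ℝ} (hR : 0 ≤ R) :
    ‖∫ x in (-R)..R, H x‖ ≤ (∫ x, φ x) * Real.exp (-c * R) + (φ R + φ (-R)) / c := by
  have hφ0 (x : ℝ) : 0 ≤ φ x := by simpa using (norm_nonneg _).trans (hbound x (by simp))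
  have hcont : ContinuousOn H {z | 0 ≤ z.im} := by
    simpa only [closure_setOfPred_lt_im] using hH.continuousOn
  have hbox : (∫ x in (-R)..R, H x) = (∫ x in (-R)..R, H (x + R * I))
      - I • (∫ y in (0 : ℝ)..R, H (R + y * I)) + I • ∫ y in (0 : ℝ)..R, H (-R + y * I) := by
    have hrect := integral_boundary_rect_eq_zero_of_continuousOn_of_differentiableOn H (-R : ℝ)
      (R + R * I) (hcont.mono fun z hz => ?_) (hH.differentiableOn.mono fun z hz => ?_)
    · simp only [ofReal_neg, neg_im, ofReal_im, neg_zero, ofReal_zero, zero_mul, add_zero, neg_re,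
        ofReal_re, add_re, mul_re, I_re, mul_zero, I_im, mul_one, sub_self, add_im, mul_im,
        zero_add] at hrect
      rw [← sub_eq_zero, ← hrect]
      abel
    · simpa [hR] using hz.2.1
    · simpa [hR] using hz.2.1
  have htop : ‖∫ x in (-R)..R, H (x + R * I)‖ ≤ (∫ x, φ x) * Real.exp (-c * R) := by
    calc ‖∫ x in (-R)..R, H (x + R * I)‖ ≤ ∫ x in (-R)..R, φ x * Real.exp (-c * R) :=
          intervalIntegral.norm_integral_le_of_norm_le (by linarith)
            (Eventually.of_forall fun x _ => by simpa using hbound (x + R * I) (by simpa using hR))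
            (hφ.intervalIntegrable.mul_const _)
      _ ≤ (∫ x, φ x) * Real.exp (-c * R) := by
        rw [intervalIntegral.integral_mul_const, intervalIntegral.integral_of_le (by linarith)]
        exact mul_le_mul_of_nonneg_right
          (setIntegral_le_integral hφ (Eventually.of_forall hφ0)) (Real.exp_pos _).le
  have hside (x : ℝ) : ‖∫ y in (0 : ℝ)..R, H (x + y * I)‖ ≤ φ x / c :=
    norm_integral_le_div_of_norm_le_exp hc hR
      fun y hy => by simpa using hbound (x + y * I) (by simpa using hy)
  have hright := hside R
  have hleft := hside (-R)
  rw [ofReal_neg] at hleft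
  rw [hbox, add_div]
  refine (norm_add_le _ _).trans ((add_le_add_left (norm_sub_le _ _) _).trans ?_)
  rw [norm_smul, norm_smul, norm_I, one_mul, one_mul]
  linarith

theorem integral_eq_zero_of_upperHalfPlane (hH : DiffContOnCl ℂ H {z | 0 < z.im}) (hc : 0 < c)
    (hφ : Integrable φ) (hφ_lim : Tendsto φ (cocompact ℝ) (𝓝 0))
    (hbound : ∀ z : ℂ, 0 ≤ z.im → ‖H z‖ ≤ φ z.re * Real.exp (-c * z.im)) :
    ∫ x : ℝ, H x = 0 := by
  have hcont : Continuous fun x : ℝ => H x := by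
    refine hH.continuousOn.comp_continuous continuous_ofReal fun x => ?_
    simp [closure_setOfPred_lt_im]
  have hinteg : Integrable fun x : ℝ => H x :=
    hφ.mono' hcont.aestronglyMeasurable
      (Eventually.of_forall fun x => by simpa using hbound x (by simp))
  rw [cocompact_eq_atBot_atTop, tendsto_sup] at hφ_lim
  have hexp : Tendsto (fun R => Real.exp (-c * R)) atTop (𝓝 0) :=
    Real.tendsto_exp_atBot.comp (tendsto_id.const_mul_atTop_of_neg (neg_lt_zero.2 hc))
  have hlim : Tendsto (fun R => (∫ x, φ x) * Real.exp (-c * R) + (φ R + φ (-R)) / c) atTop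
      (𝓝 0) := by
    simpa using (hexp.const_mul (∫ x, φ x)).add
      ((hφ_lim.2.add (hφ_lim.1.comp tendsto_neg_atTop_atBot)).div_const c)
  refine tendsto_nhds_unique
    (intervalIntegral_tendsto_integral hinteg tendsto_neg_atTop_atBot tendsto_id)
    (squeeze_zero_norm' ?_ hlim)
  filter_upwards [eventually_ge_atTop 0] with R hR
  exact norm_integral_symm_interval_le_of_upperHalfPlane hH hc hφ hbound hR

end ContourShift

section Damping

/-- The damping factor `(1 - iεz)⁻²`. It is holomorphic and bounded by `1` on the upper half-plane,
decays quadratically along the real line for `ε > 0`, and tends to `1` as `ε → 0`. -/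
noncomputable def damping (ε : ℝ) (z : ℂ) : ℂ :=
  ((1 - I * ε * z) ^ 2)⁻¹

variable {ε : ℝ} {z : ℂ}

theorem one_add_mul_re_sq_le_norm_sq (hε : 0 ≤ ε) (hz : 0 ≤ z.im) :
    1 + (ε * z.re) ^ 2 ≤ ‖(1 - I * ε * z) ^ 2‖ := by
  have hnormSq : ‖(1 - I * ε * z) ^ 2‖ = (1 + ε * z.im) ^ 2 + (ε * z.re) ^ 2 := by
    rw [norm_pow, ← normSq_eq_norm_sq, normSq_apply]
    simp only [sub_re, one_re, mul_re, I_re, ofReal_re, zero_mul, I_im, ofReal_im, mul_zero,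
      sub_self, mul_im, one_mul, zero_add, zero_sub, sub_neg_eq_add, sub_im, one_im, mul_neg,
      neg_mul, neg_neg]
    ring
  rw [hnormSq]
  gcongr
  exact one_le_pow₀ (le_add_of_nonneg_right (mul_nonneg hε hz))

theorem norm_damping_le (hε : 0 ≤ ε) (hz : 0 ≤ z.im) :
    ‖damping ε z‖ ≤ (1 + (ε * z.re) ^ 2)⁻¹ := by
  rw [damping, norm_inv]
  exact inv_anti₀ (by positivity) (one_add_mul_re_sq_le_norm_sq hε hz)

theorem norm_damping_le_one (hε : 0 ≤ ε) (hz : 0 ≤ z.im) : ‖damping ε z‖ ≤ 1 :=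
  (norm_damping_le hε hz).trans (inv_le_one_of_one_le₀ (le_add_of_nonneg_right (sq_nonneg _)))

theorem differentiableAt_damping (hε : 0 ≤ ε) (hz : 0 ≤ z.im) :
    DifferentiableAt ℂ (damping ε) z := by
  have hne : (1 - I * ε * z) ^ 2 ≠ 0 := norm_pos_iff.1
    ((by positivity : 0 < 1 + (ε * z.re) ^ 2).trans_le (one_add_mul_re_sq_le_norm_sq hε hz))
  unfold damping
  fun_prop (disch := exact hne)

theorem continuous_damping_ofReal (hε : 0 ≤ ε) : Continuous fun t : ℝ => damping ε t :=
  continuous_iff_continuousAt.2 fun t =>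
    (differentiableAt_damping hε (by simp)).continuousAt.comp (f := ofReal)
      continuous_ofReal.continuousAt

theorem integrable_damping_ofReal (hε : 0 < ε) : Integrable fun t : ℝ => damping ε t :=
  (integrable_inv_one_add_sq.comp_mul_left' hε.ne').mono'
    (continuous_damping_ofReal hε.le).aestronglyMeasurable
    (Eventually.of_forall fun t => by simpa using norm_damping_le (z := t) hε.le (by simp))

theorem tendsto_damping (z : ℂ) : Tendsto (fun ε => damping ε z) (𝓝 0) (𝓝 1) := by
  have hcont : ContinuousAt (fun ε : ℝ => damping ε z) 0 := by
    unfold damping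
    fun_prop (disch := simp)
  simpa [damping] using hcont.tendsto

theorem tendsto_integral_damping_smul {E : Type*} [NormedAddCommGroup E] [NormedSpace ℂ E]
    {ψ : ℝ → E} (hψ : Integrable ψ) :
    Tendsto (fun ε => ∫ t : ℝ, damping ε t • ψ t) (𝓝[>] 0) (𝓝 (∫ t, ψ t)) := by
  refine tendsto_integral_filter_of_dominated_convergence (fun t => ‖ψ t‖) ?_ ?_ hψ.norm ?_
  · filter_upwards [self_mem_nhdsWithin] with ε hε
    exact (continuous_damping_ofReal (le_of_lt hε)).aestronglyMeasurable.smul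
      hψ.aestronglyMeasurable
  · filter_upwards [self_mem_nhdsWithin] with ε hε
    refine Eventually.of_forall fun t => ?_
    rw [norm_smul]
    exact mul_le_of_le_one_left (norm_nonneg _) (norm_damping_le_one (le_of_lt hε) (by simp))
  · refine Eventually.of_forall fun t => ?_
    simpa using ((tendsto_damping t).mono_left nhdsWithin_le_nhds).smul_const (ψ t)

end Damping

section PaleyWiener

variable {f : ℂ → ℂ} {β M : ℝ}

theorem HasExpType.fourier_damping_mul_eq_zero (hf : HasExpType f β) (hM : ∀ x : ℝ, ‖f x‖ ≤ M)
    {ε : ℝ} (hε : 0 < ε) {ω : ℝ} (hω : β < -2 * Real.pi * ω) :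
    𝓕 (fun t : ℝ => damping ε t * f t) ω = 0 := by
  set H : ℂ → ℂ := fun z => cexp (-2 * Real.pi * ω * I * z) * (damping ε z * f z) with hH
  have hdiff : DiffContOnCl ℂ H {z | 0 < z.im} := by
    apply DifferentiableOn.diffContOnCl
    rw [closure_setOfPred_lt_im]
    exact fun z hz => (DifferentiableAt.mul (by fun_prop) ((differentiableAt_damping hε.le hz).mul
      (hf.differentiable z))).differentiableWithinAt
  have hbound (z : ℂ) (hz : 0 ≤ z.im) :
      ‖H z‖ ≤ M * (1 + (ε * z.re) ^ 2)⁻¹ * Real.exp (-(-2 * Real.pi * ω - β) * z.im) := by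
    have hgrowth : ‖f z‖ ≤ M * Real.exp (β * z.im) := by
      simpa [abs_of_nonneg hz] using
        hf.norm_le_of_norm_le_real_axis (n := 0) le_rfl (by simpa using hM) z
    calc ‖H z‖ = Real.exp (2 * Real.pi * ω * z.im) * (‖damping ε z‖ * ‖f z‖) := by
          simp [hH, norm_exp]
      _ ≤ Real.exp (2 * Real.pi * ω * z.im)
          * ((1 + (ε * z.re) ^ 2)⁻¹ * (M * Real.exp (β * z.im))) := by
        gcongr
        exact norm_damping_le hε.le hz
      _ = M * (1 + (ε * z.re) ^ 2)⁻¹ * Real.exp (-(-2 * Real.pi * ω - β) * z.im) := by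
        rw [show -(-2 * Real.pi * ω - β) * z.im = 2 * Real.pi * ω * z.im + β * z.im by ring,
          Real.exp_add]
        ring
  have hdecay : Tendsto (fun x : ℝ => M * (1 + (ε * x) ^ 2)⁻¹) (cocompact ℝ) (𝓝 0) := by
    have hsq : Tendsto (fun x : ℝ => (ε * x) ^ 2) (cocompact ℝ) atTop := by
      simpa [mul_pow] using ((tendsto_pow_atTop two_ne_zero).comp
        (tendsto_norm_cocompact_atTop (E := ℝ))).const_mul_atTop (pow_pos hε 2)
    simpa using ((tendsto_atTop_add_const_left _ 1 hsq).inv_tendsto_atTop).const_mul M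
  rw [Real.fourier_real_eq_integral_exp_smul, ← integral_eq_zero_of_upperHalfPlane hdiff
    (sub_pos.2 hω) ((integrable_inv_one_add_sq.comp_mul_left' hε.ne').const_mul M) hdecay hbound]
  refine integral_congr_ae (Eventually.of_forall fun t => ?_)
  simp only [hH, smul_eq_mul]
  push_cast
  ring_nf

theorem integral_fourier_mul_eq_zero_of_eq_zero_right {b : ℝ}
    (hf : ∀ β, Real.pi * b < β → HasExpType f β) (hM : ∀ x : ℝ, ‖f x‖ ≤ M) {φ : ℝ → ℂ}
    (hφ : Integrable φ) (hφ' : Integrable (𝓕 φ)) (hsupp : ∀ ω, -(b / 2) ≤ ω → φ ω = 0) :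
    ∫ t : ℝ, 𝓕 φ t * f t = 0 := by
  have hmeas : AEStronglyMeasurable (fun t : ℝ => f t) :=
    ((hf _ (lt_add_one _)).differentiable.continuous.comp continuous_ofReal).aestronglyMeasurable
  have hzero (ε : ℝ) (hε : 0 < ε) : ∫ t : ℝ, damping ε t * (𝓕 φ t * f t) = 0 := by
    have hparseval : ∫ t : ℝ, 𝓕 φ t • (damping ε t * f t)
        = ∫ ω : ℝ, φ ω • 𝓕 (fun t : ℝ => damping ε t * f t) ω := by
      simpa using! VectorFourier.integral_fourierIntegral_smul_eq_flip (L := innerₗ ℝ)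
        Real.continuous_fourierChar continuous_inner hφ
        ((integrable_damping_ofReal hε).mul_bdd hmeas (Eventually.of_forall hM))
    calc ∫ t : ℝ, damping ε t * (𝓕 φ t * f t) = ∫ t : ℝ, 𝓕 φ t • (damping ε t * f t) := by
          simp only [smul_eq_mul, mul_left_comm]
      _ = ∫ ω : ℝ, φ ω • 𝓕 (fun t : ℝ => damping ε t * f t) ω := hparseval
      _ = 0 := by
        refine integral_eq_zero_of_ae (Eventually.of_forall fun ω => ?_)
        rcases lt_or_ge ω (-(b / 2)) with hω | hω
        · obtain ⟨β, hbβ, hβω⟩ : ∃ β, Real.pi * b < β ∧ β < -2 * Real.pi * ω :=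
            exists_between (by nlinarith [Real.pi_pos])
          simp [(hf β hbβ).fourier_damping_mul_eq_zero hM hε hβω]
        · simp [hsupp ω hω]
  refine tendsto_nhds_unique (tendsto_integral_damping_smul
    (hφ'.mul_bdd hmeas (Eventually.of_forall hM))) (tendsto_const_nhds.congr' ?_)
  filter_upwards [self_mem_nhdsWithin] with ε hε using (hzero ε hε).symm

theorem integral_fourier_mul_eq_zero_of_eq_zero_left {b : ℝ}
    (hf : ∀ β, Real.pi * b < β → HasExpType f β) (hM : ∀ x : ℝ, ‖f x‖ ≤ M) {φ : ℝ → ℂ}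
    (hφ : Integrable φ) (hφ' : Integrable (𝓕 φ)) (hsupp : ∀ ω, ω ≤ b / 2 → φ ω = 0) :
    ∫ t : ℝ, 𝓕 φ t * f t = 0 := by
  have hneg : 𝓕 (fun ω => φ (-ω)) = fun t => 𝓕 φ (-t) := by
    ext t
    rw [← Real.fourierInv_eq_fourier_comp_neg, Real.fourierInv_eq_fourier_neg]
  have hreflected := integral_fourier_mul_eq_zero_of_eq_zero_right (f := fun z => f (-1 * z))
    (fun β hβ => (hf β hβ).comp_const_mul (by simp)) (fun x => by simpa using hM (-x))
    hφ.comp_neg (hneg ▸ hφ'.comp_neg) (fun ω hω => hsupp _ (by linarith))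
  rw [← integral_neg_eq_self]
  simpa [hneg] using hreflected

theorem mem_PW_of_integral_fourier_mul_eq_zero {b : ℝ} {p : ℝ≥0∞} [Fact (1 ≤ p)] {g : ℝ → ℂ}
    (hg : MemLp g p) (hleft : ∀ u : 𝓢(ℝ, ℂ), tsupport u ⊆ Iio (-(b / 2)) → ∫ t, 𝓕 ⇑u t * g t = 0)
    (hright : ∀ u : 𝓢(ℝ, ℂ), tsupport u ⊆ Ioi (b / 2) → ∫ t, 𝓕 ⇑u t * g t = 0) : g ∈ PW b p := by
  have happly (u : 𝓢(ℝ, ℂ)) : (𝓕 (hg.toLp g : 𝓢'(ℝ, ℂ)) : 𝓢'(ℝ, ℂ)) u = ∫ t, 𝓕 ⇑u t * g t := by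
    rw [TemperedDistribution.fourier_apply, Lp.toTemperedDistribution_apply]
    refine integral_congr_ae ?_
    filter_upwards [hg.coeFn_toLp] with t ht
    rw [ht, smul_eq_mul, SchwartzMap.fourier_coe]
  refine ⟨hg, fun ω hω => ?_⟩
  by_contra hout
  rw [Distribution.mem_dsupport_iff_not_isVanishingOn] at hω
  rw [mem_Icc, not_and_or, not_le, not_le] at hout
  rcases hout with h | h
  · exact hω _ h isOpen_Iio fun u hu => (happly u).trans (hleft u hu)
  · exact hω _ h isOpen_Ioi fun u hu => (happly u).trans (hright u hu)

theorem mem_PW_top_of_norm_le {b : ℝ} (hf : ∀ β, Real.pi * b < β → HasExpType f β)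
    (hM : ∀ x : ℝ, ‖f x‖ ≤ M) : (fun t : ℝ => f t) ∈ PW b ∞ := by
  have hcont : Continuous fun t : ℝ => f t :=
    (hf _ (lt_add_one _)).differentiable.continuous.comp continuous_ofReal
  have hinteg (u : 𝓢(ℝ, ℂ)) : Integrable (𝓕 ⇑u) := by
    rw [← SchwartzMap.fourier_coe]
    exact (𝓕 u).integrable
  refine mem_PW_of_integral_fourier_mul_eq_zero
    (memLp_top_of_bound hcont.aestronglyMeasurable M (Eventually.of_forall hM))
    (fun u hu => integral_fourier_mul_eq_zero_of_eq_zero_right hf hM u.integrable (hinteg u)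
      fun ω hω => ?_)
    (fun u hu => integral_fourier_mul_eq_zero_of_eq_zero_left hf hM u.integrable (hinteg u)
      fun ω hω => ?_)
  · exact image_eq_zero_of_notMem_tsupport fun hmem => (hu hmem).not_ge hω
  · exact image_eq_zero_of_notMem_tsupport fun hmem => (hu hmem).not_ge hω

end PaleyWiener

section Sampling

theorem hasExpType_of_exponentialType_lt {f : ℂ → ℂ} {β : ℝ} (h : exponentialType f < β) :
    HasExpType f β := by
  simp only [exponentialType, iInf_lt_iff] at h
  obtain ⟨β', ⟨hd, hexp⟩, hlt⟩ := h
  exact HasExpType.mono ⟨hd, hexp⟩ (EReal.coe_lt_coe_iff.1 hlt).le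

theorem exists_norm_le_of_lipschitzWith_of_isCover {α E : Type*} [PseudoMetricSpace α]
    [SeminormedAddCommGroup E] {g : α → E} {L R : ℝ≥0} (hg : LipschitzWith L g) {S : Set α}
    (hS : IsCover R univ S) {K : ℝ} (hK : ∀ y ∈ S, ‖g y‖ ≤ K) : ∃ M, ∀ x, ‖g x‖ ≤ M := by
  refine ⟨K + L * R, fun x => ?_⟩
  obtain ⟨y, hy, hxy⟩ := hS (mem_univ x)
  have hdist : dist x y ≤ R := edist_le_coe.1 hxy
  calc ‖g x‖ ≤ ‖g y‖ + ‖g x - g y‖ := norm_le_norm_add_norm_sub' _ _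
    _ ≤ K + L * R := add_le_add (hK y hy) <| by
      rw [← dist_eq_norm]
      exact (hg.dist_le_mul x y).trans (by gcongr)

theorem isCover_of_forall_exists_mem_Ico {S : Set ℝ} {r : ℝ}
    (hS : ∀ a, ∃ y ∈ S, y ∈ Ico a (a + r)) : IsCover r.toNNReal univ S := by
  refine isCover_iff_subset_iUnion_closedBall.2 fun a _ => ?_
  obtain ⟨y, hyS, hay, hya⟩ := hS a
  refine mem_iUnion₂.2 ⟨y, hyS, mem_closedBall.2 ?_⟩
  rw [dist_comm, Real.dist_eq, abs_of_nonneg (sub_nonneg.2 hay)]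
  exact (sub_le_iff_le_add'.2 hya.le).trans (Real.le_coe_toNNReal r)

theorem exists_isCover_range_of_lowerUniformDensity_pos {x : ℤ → ℝ}
    (hx : 0 < lowerUniformDensity x) : ∃ R : ℝ≥0, IsCover R univ (range x) := by
  obtain ⟨r, hr⟩ := (frequently_lt_of_lt_limsup (by isBoundedDefault) hx).exists
  refine ⟨_, isCover_of_forall_exists_mem_Ico (r := r) fun a => ?_⟩
  rw [exists_range_iff]
  by_contra hempty
  have hcount : pointCount x (Ico a (a + r)) = 0 :=
    encard_eq_zero.2 (eq_empty_iff_forall_notMem.2 (not_exists.1 hempty))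
  have hmean := hr.trans_le (iInf_le _ a)
  simp [hcount] at hmean

theorem isCover_range_intCast_div {s : ℝ} (hs : 0 < s) :
    IsCover (s⁻¹).toNNReal univ (range fun k : ℤ => (k : ℝ) / s) := by
  refine isCover_of_forall_exists_mem_Ico fun a => ⟨_, ⟨⌈a * s⌉, rfl⟩, ?_, ?_⟩
  · exact (le_div_iff₀ hs).2 (Int.le_ceil _)
  · rw [div_lt_iff₀ hs, add_mul, inv_mul_cancel₀ hs.ne']
    exact Int.ceil_lt_add_one _

end Sampling

end BandlimitedBMO

theorem mainTheorem4_general {b : ℝ} {f : ℂ → ℂ} (hf : f ∈ BandlimitedBMO.PWStar b) {ι : Type*}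
    {x : ι → ℝ} {R : NNReal} (hx : Metric.IsCover R Set.univ (Set.range x))
    (hbdd : Memℓp (fun k => f (x k)) ∞) : (fun t : ℝ => f t) ∈ BandlimitedBMO.PW b ∞ := by
  have htype (β : ℝ) (hβ : Real.pi * b < β) : BandlimitedBMO.HasExpType f β :=
    BandlimitedBMO.hasExpType_of_exponentialType_lt (hf.1.trans_lt (EReal.coe_lt_coe hβ))
  have hfexp := htype _ (lt_add_one _)
  obtain ⟨L, hL⟩ := hfexp.exists_norm_deriv_le hf.2
  have hderiv (t : ℝ) : HasDerivAt (fun t : ℝ => f t) (deriv f t) t :=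
    (hfexp.differentiable t).hasDerivAt.comp_ofReal
  have hlip : LipschitzWith L.toNNReal fun t : ℝ => f t :=
    lipschitzWith_of_nnnorm_deriv_le (fun t => (hderiv t).differentiableAt) fun t =>
      (hderiv t).deriv ▸ NNReal.le_toNNReal_of_coe_le (hL t)
  obtain ⟨K, hK⟩ := memℓp_infty_iff.1 hbdd
  obtain ⟨M, hM⟩ := BandlimitedBMO.exists_norm_le_of_lipschitzWith_of_isCover hlip hx
    (Set.forall_mem_range.2 fun k => hK ⟨k, rfl⟩)
  exact BandlimitedBMO.mem_PW_top_of_norm_le htype hM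

theorem mainTheorem4 (b : ℝ) (hb : 0 ≤ b) (f : ℂ → ℂ) (hf : f ∈ BandlimitedBMO.PWStar b) :
    ((fun t : ℝ => f t) ∈ BandlimitedBMO.PW b ∞ ∨
      ¬ ∃ x : ℤ → ℝ, BandlimitedBMO.IsSeparatedSeq x ∧
        0 < BandlimitedBMO.lowerUniformDensity x ∧
        Memℓp (fun k : ℤ => f (x k)) ∞) ∧
    ((fun t : ℝ => f t) ∉ BandlimitedBMO.PW b ∞ →
      ∀ s : ℝ, 0 < s → ¬ Memℓp (fun k : ℤ => f (((k : ℝ) / s : ℝ) : ℂ)) ∞) := by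
  refine ⟨or_iff_not_imp_left.2 ?_, fun hPW s hs hbdd =>
    hPW (mainTheorem4_general hf (BandlimitedBMO.isCover_range_intCast_div hs) hbdd)⟩
  rintro hPW ⟨x, -, hdens, hbdd⟩
  obtain ⟨R, hR⟩ := BandlimitedBMO.exists_isCover_range_of_lowerUniformDensity_pos hdens
  exact hPW (mainTheorem4_general hf hR hbdd)
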